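/- Let $n\ge 1$ and let $\mathcal E$ be a complex Hilbert space. For a Hilbert space $\mathcal F$, let $H^2_{\mathcal F}(\mathbb D^n)$ be the $\mathcal F$-valued Hardy space over the polydisc, i.e. the Hilbert space of functions $f(\mathbf z)=\sum_{\mathbf k\in\mathbb Z_+^n}\mathbf z^{\mathbf k}a_{\mathbf k}$ on $\mathbb D^n$ with $\|f\|^2=\sum_{\mathbf k}\|a_{\mathbf k}\|^2<\infty$ (the reproducing kernel Hilbert space with kernel $\prod_{i=1}^n(1-z_i\bar w_i)^{-1}I_{\mathcal F}$). Put $\mathcal E_n=H^2_{\mathcal E}(\mathbb D^n)\cong H^2(\mathbb D^n)\otimes\mathcal E$. On $H^2_{\mathcal E_n}(\mathbb D)$ let $M_z$ be multiplication by the coordinate function and, for $i=1,\dots,n$, let $M_{\kappa_i}$ be multiplication by the constant $\mathcal B(\mathcal E_n)$-valued function $\kappa_i(w)=M_{z_i}$, where $M_{z_i}$ is multiplication by $z_i$ on $\mathcal E_n$. Let $\mathcal S\subseteq H^2_{\mathcal E_n}(\mathbb D)$ be a closed subspace that is invariant for $(M_z,M_{\kappa_1},\dots,M_{\kappa_n})$,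 let $\mathcal W=\mathcal S\ominus z\mathcal S$, and let $$\Phi_i(w)=P_{\mathcal W}\,(I_{\mathcal S}-w\,P_{\mathcal S}M_z^*|_{\mathcal S})^{-1}\,M_{\kappa_i}|_{\mathcal W}\qquad(w\in\mathbb D,\ i=1,\dots,n).$$ Then $(M_z|_{\mathcal S},M_{\kappa_1}|_{\mathcal S},\dots,M_{\kappa_n}|_{\mathcal S})$ is a tuple of commuting isometries on $\mathcal S$; each $\Phi_i$ is a bounded analytic $\mathcal B(\mathcal W)$-valued function on $\mathbb D$ and pointwise multiplication by $\Phi_i$ is an operator $M_{\Phi_i}$ on $H^2_{\mathcal W}(\mathbb D)$; and the tuples $(M_z|_{\mathcal S},M_{\kappa_1}|_{\mathcal S},\dots,M_{\kappa_n}|_{\mathcal S})$ on $\mathcal S$ and $(M_z,M_{\Phi_1},\dots,M_{\Phi_n})$ on $H^2_{\mathcal W}(\mathbb D)$ are unitarily equivalent, i.e. a single unitary $U:\mathcal S\to H^2_{\mathcal W}(\mathbb D)$ satisfies $U\,M_z|_{\mathcal S}=M_zU$ and $U\,M_{\kappa_i}|_{\mathcal S}=M_{\Phi_i}U$ for all $i$.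 -/

import Mathlib

/-- The open unit polydisc `𝔻ⁿ` in `ℂⁿ`. The disc `𝔻` is `Polydisc 1`. -/
def Polydisc (n : ℕ) : Set (Fin n → ℂ) := {z | ∀ i, ‖z i‖ < 1}

/-- The monomial `z ^ k = z₁ ^ k₁ ⋯ zₙ ^ kₙ`. -/
def monomialAt {n : ℕ} (z : Fin n → ℂ) (k : Fin n → ℕ) : ℂ := ∏ i, z i ^ k i

theorem hasSum_monomialAt {n : ℕ} {z : Fin n → ℂ} (hz : z ∈ Polydisc n) :
    HasSum (monomialAt z) (∏ i, (1 - z i)⁻¹) ∧ Summable fun k => ‖monomialAt z k‖ := by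
  induction n with
  | zero =>
    constructor
    · have := hasSum_fintype (monomialAt z)
      simpa [monomialAt] using this
    · exact (hasSum_fintype _).summable
  | succ n ih =>
    obtain ⟨h1, h2⟩ := ih (z := fun i => z i.succ) (fun i => hz i.succ)
    have g1 := hasSum_geometric_of_norm_lt_one (hz 0)
    have g2 : Summable fun m : ℕ => ‖z 0 ^ m‖ := by
      simpa using summable_geometric_of_lt_one (norm_nonneg _) (hz 0)
    have key : ∀ p : ℕ × (Fin n → ℕ), monomialAt z (Fin.consEquiv (fun _ => ℕ) p) =
        z 0 ^ p.1 * monomialAt (fun i => z i.succ) p.2 := by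
      intro p
      simp [monomialAt, Fin.prod_univ_succ, Fin.consEquiv]
    constructor
    · rw [← (Fin.consEquiv (fun _ => ℕ)).hasSum_iff, Fin.prod_univ_succ]
      have := g1.mul h1 (summable_mul_of_summable_norm g2 h2)
      refine this.congr_fun ?_
      intro p; exact (key p)
    · rw [← (Fin.consEquiv (fun _ => ℕ)).summable_iff]
      refine (g2.mul_of_nonneg h2 (fun _ => norm_nonneg _) (fun _ => norm_nonneg _)).congr ?_
      intro p
      simp only [Function.comp_apply, key, norm_mul]

theorem summable_monomialAt_smul {E : Type*} [NormedAddCommGroup E] [NormedSpace ℂ E]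
    [CompleteSpace E] {n : ℕ} {a : (Fin n → ℕ) → E} {C : ℝ} (ha : ∀ k, ‖a k‖ ≤ C)
    {z : Fin n → ℂ} (hz : z ∈ Polydisc n) : Summable fun k => monomialAt z k • a k := by
  refine Summable.of_norm_bounded ((hasSum_monomialAt hz).2.mul_right C) fun k => ?_
  rw [norm_smul]
  exact mul_le_mul_of_nonneg_left (ha k) (norm_nonneg _)

theorem coeff_eq_zero_of_one_variable {E : Type*} [NormedAddCommGroup E] [NormedSpace ℂ E]
    [CompleteSpace E] {a : ℕ → E} {C : ℝ} (ha : ∀ k, ‖a k‖ ≤ C)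
    (h : ∀ w : ℂ, ‖w‖ < 1 → ∑' k, w ^ k • a k = 0) : a = 0 := by
  let p : FormalMultilinearSeries ℂ ℂ E := fun k => ContinuousMultilinearMap.mkPiRing ℂ (Fin k) (a k)
  have hp : HasFPowerSeriesOnBall (fun _ : ℂ => (0 : E)) p 0 1 := by
    refine ⟨?_, one_pos, ?_⟩
    · have := p.le_radius_of_bound (r := 1) C (fun k => by simpa [p] using ha k)
      simpa using this
    · intro y hy
      have hy' : ‖y‖ < 1 := by
        rw [Metric.mem_eball, edist_zero_right, ← ofReal_norm] at hy
        exact ENNReal.ofReal_lt_one.mp hy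
      have hs : Summable fun k => y ^ k • a k := by
        refine Summable.of_norm_bounded
          ((summable_geometric_of_lt_one (norm_nonneg y) hy').mul_right C) fun k => ?_
        rw [norm_smul, norm_pow]
        exact mul_le_mul_of_nonneg_left (ha k) (by positivity)
      have := hs.hasSum
      rw [h y hy'] at this
      simpa [p] using this
  have hp0 := hp.hasFPowerSeriesAt.eq_zero
  funext k
  have := congrArg (fun q : FormalMultilinearSeries ℂ ℂ E => q k fun _ => 1) hp0
  simpa [p] using this

/-- A power series with bounded coefficients that vanishes on the polydisc is zero. -/
theorem coeff_eq_zero {E : Type*} [NormedAddCommGroup E] [NormedSpace ℂ E]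
    [CompleteSpace E] {n : ℕ} {a : (Fin n → ℕ) → E} {C : ℝ} (ha : ∀ k, ‖a k‖ ≤ C)
    (h : ∀ z ∈ Polydisc n, ∑' k, monomialAt z k • a k = 0) : a = 0 := by
  induction n with
  | zero =>
    funext k
    have := h (fun i => i.elim0) (fun i => i.elim0)
    rw [tsum_fintype] at this
    rw [Subsingleton.elim k (@default (Fin 0 → ℕ) Unique.instInhabited), Pi.zero_apply]
    simp only [Finset.univ_unique, Finset.sum_singleton] at this
    simpa only [monomialAt, Finset.univ_eq_empty, Finset.prod_empty, one_smul] using this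
  | succ n ih =>
    have key : ∀ (w : ℂ) (z : Fin n → ℂ) (m : ℕ) (k : Fin n → ℕ),
        monomialAt (Fin.cons w z : Fin (n + 1) → ℂ) (Fin.cons m k : Fin (n + 1) → ℕ) =
          w ^ m * monomialAt z k := by
      intro w z m k
      simp [monomialAt, Fin.prod_univ_succ]
    have main : ∀ z ∈ Polydisc n, (fun m : ℕ => ∑' k, monomialAt z k •
        a (Fin.cons m k : Fin (n + 1) → ℕ)) = 0 := by
      intro z hz
      have hsz := (hasSum_monomialAt hz).2
      refine coeff_eq_zero_of_one_variable (C := (∑' k, ‖monomialAt z k‖) * C) (fun m => ?_)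
        (fun w hw => ?_)
      · refine tsum_of_norm_bounded (hsz.hasSum.mul_right C) fun k => ?_
        rw [norm_smul]
        exact mul_le_mul_of_nonneg_left (ha _) (norm_nonneg _)
      · have hwz : (Fin.cons w z : Fin (n + 1) → ℂ) ∈ Polydisc (n + 1) := by
          intro i
          refine Fin.cases ?_ (fun j => ?_) i
          · simpa using hw
          · simpa using hz j
        have hs := summable_monomialAt_smul ha hwz
        have h0 := h _ hwz
        rw [← (Fin.consEquiv (fun _ => ℕ)).summable_iff] at hs
        rw [← (Fin.consEquiv (fun _ => ℕ)).tsum_eq] at h0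
        rw [← h0]
        have e : ∀ p : ℕ × (Fin n → ℕ), monomialAt (Fin.cons w z : Fin (n + 1) → ℂ)
            (Fin.consEquiv (fun _ => ℕ) p) • a (Fin.consEquiv (fun _ => ℕ) p) =
            w ^ p.1 • (monomialAt z p.2 • a (Fin.cons p.1 p.2 : Fin (n + 1) → ℕ)) := by
          intro p
          rw [smul_smul, ← key]
          rfl
        have hs' : Summable fun p : ℕ × (Fin n → ℕ) =>
            w ^ p.1 • (monomialAt z p.2 • a (Fin.cons p.1 p.2 : Fin (n + 1) → ℕ)) :=
          hs.congr e
        rw [tsum_congr e, hs'.tsum_prod]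
        refine tsum_congr fun m => ?_
        exact ((summable_monomialAt_smul (a := fun k => a (Fin.cons m k : Fin (n + 1) → ℕ))
          (fun k => ha _) hz).tsum_const_smul (w ^ m)).symm
    funext k
    have hm := ih (a := fun k' => a (Fin.cons (k 0) k' : Fin (n + 1) → ℕ)) (fun k' => ha _)
      (fun z hz => congrFun (main z hz) (k 0))
    have := congrFun hm (Fin.tail k)
    simpa using this

/-- The `E`-valued Hardy space `H²_E(𝔻ⁿ)`: the Hilbert space of the functions
`f(z) = ∑ₖ zᵏ aₖ` on `𝔻ⁿ` with `‖f‖² = ∑ₖ ‖aₖ‖² < ∞`. An element is stored through its Taylor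
coefficients; it is read as a function on `𝔻ⁿ` by the `RKHS` instance below, and
`kernel_HardySpace` shows that the reproducing kernel is the Szegő kernel times `I_E`. -/
def HardySpace (n : ℕ) (E : Type*) [NormedAddCommGroup E] [InnerProductSpace ℂ E] : Type _ :=
  lp (fun _ : Fin n → ℕ => E) 2

namespace HardySpace

section Basic

variable {n : ℕ} {E : Type*} [NormedAddCommGroup E] [InnerProductSpace ℂ E]

noncomputable instance : NormedAddCommGroup (HardySpace n E) :=
  inferInstanceAs (NormedAddCommGroup (lp (fun _ : Fin n → ℕ => E) 2))

noncomputable instance : InnerProductSpace ℂ (HardySpace n E) :=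
  inferInstanceAs (InnerProductSpace ℂ (lp (fun _ : Fin n → ℕ => E) 2))

instance [CompleteSpace E] : CompleteSpace (HardySpace n E) :=
  inferInstanceAs (CompleteSpace (lp (fun _ : Fin n → ℕ => E) 2))

/-- The function with given square summable Taylor coefficients. -/
def ofCoeff (a : lp (fun _ : Fin n → ℕ => E) 2) : HardySpace n E := a

/-- The `k`-th Taylor coefficient. -/
def coeff (f : HardySpace n E) (k : Fin n → ℕ) : E := (show lp (fun _ : Fin n → ℕ => E) 2 from f) k

theorem norm_coeff_le (f : HardySpace n E) (k : Fin n → ℕ) : ‖f.coeff k‖ ≤ ‖f‖ :=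
  lp.norm_apply_le_norm (E := fun _ : Fin n → ℕ => E) two_ne_zero f k

theorem ext_coeff {f g : HardySpace n E} (h : ∀ k, f.coeff k = g.coeff k) : f = g :=
  lp.ext (E := fun _ : Fin n → ℕ => E) (funext h)

end Basic

section Functions

variable {n : ℕ} {E : Type*} [NormedAddCommGroup E] [InnerProductSpace ℂ E] [CompleteSpace E]

/-- Evaluation `f ↦ f(z) = ∑ₖ zᵏ aₖ` at a point of the polydisc. -/
noncomputable def evalCLM (z : Polydisc n) : HardySpace n E →L[ℂ] E :=
  LinearMap.mkContinuous
    { toFun := fun f => ∑' k, monomialAt z.1 k • f.coeff k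
      map_add' := fun f g => by
        rw [← (summable_monomialAt_smul f.norm_coeff_le z.2).tsum_add
          (summable_monomialAt_smul g.norm_coeff_le z.2)]
        exact tsum_congr fun k => smul_add _ _ _
      map_smul' := fun c f => by
        rw [RingHom.id_apply, ← (summable_monomialAt_smul f.norm_coeff_le z.2).tsum_const_smul]
        exact tsum_congr fun k => smul_comm _ _ _ }
    (∑' k, ‖monomialAt z.1 k‖)
    (fun f => tsum_of_norm_bounded ((hasSum_monomialAt z.2).2.hasSum.mul_right ‖f‖) fun k => by
      rw [norm_smul]
      exact mul_le_mul_of_nonneg_left (f.norm_coeff_le k) (norm_nonneg _))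

/-- The elements of `H²_E(𝔻ⁿ)` are functions on the polydisc. -/
noncomputable instance : RKHS ℂ (HardySpace n E) (Polydisc n) E where
  coeCLM := ContinuousLinearMap.pi evalCLM
  coeCLM_injective := by
    refine (injective_iff_map_eq_zero _).mpr fun f hf => ?_
    have := coeff_eq_zero (a := f.coeff) f.norm_coeff_le
      (fun z hz => congrFun hf ⟨z, hz⟩)
    exact ext_coeff fun k => congrFun this k

theorem apply_eq_tsum (f : HardySpace n E) (z : Polydisc n) :
    f z = ∑' k, monomialAt z.1 k • f.coeff k := rfl

theorem hasSum_apply (f : HardySpace n E) (z : Polydisc n) :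
    HasSum (fun k => monomialAt z.1 k • f.coeff k) (f z) :=
  (summable_monomialAt_smul f.norm_coeff_le z.2).hasSum

/-- The reproducing kernel of `H²_E(𝔻ⁿ)` is `(z, w) ↦ ∏ᵢ (1 - zᵢ w̄ᵢ)⁻¹ I_E`. -/
theorem kernel_HardySpace (z w : Polydisc n) :
    RKHS.kernel (HardySpace n E) z w =
      (∏ i, (1 - z.1 i * starRingEnd ℂ (w.1 i))⁻¹) • ContinuousLinearMap.id ℂ E := by
  have hc : ∀ k, ‖monomialAt w.1 k‖ ≤ 1 := fun k => by
    rw [monomialAt, norm_prod]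
    exact Finset.prod_le_one (fun _ _ => norm_nonneg _) fun i _ => by
      rw [norm_pow]; exact pow_le_one₀ (norm_nonneg _) (w.2 i).le
  ext η
  rw [← RKHS.kerFun_apply]
  have hmem : Memℓp (fun k : Fin n → ℕ => starRingEnd ℂ (monomialAt w.1 k) • η) 2 := by
    refine memℓp_gen ?_
    refine Summable.of_nonneg_of_le (fun _ => by positivity) (fun k => ?_)
      ((hasSum_monomialAt w.2).2.mul_right (‖η‖ ^ 2))
    have e : ‖starRingEnd ℂ (monomialAt w.1 k) • η‖ = ‖monomialAt w.1 k‖ * ‖η‖ := by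
      rw [norm_smul, RCLike.norm_conj]
    rw [e]
    norm_num
    rw [mul_pow]
    refine mul_le_mul_of_nonneg_right ?_ (by positivity)
    have h0 := norm_nonneg (monomialAt w.1 k)
    nlinarith [hc k]
  let g : HardySpace n E := ofCoeff ⟨_, hmem⟩
  have hg : ∀ k, g.coeff k = starRingEnd ℂ (monomialAt w.1 k) • η := fun _ => rfl
  have hk : RKHS.kerFun (HardySpace n E) w η = g := by
    refine ext_inner_right ℂ fun f => ?_
    rw [RKHS.kerFun_inner]
    have h1 : HasSum (fun k => inner ℂ η (monomialAt w.1 k • f.coeff k)) (inner ℂ η (f w)) :=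
      (innerSL ℂ η).hasSum (f.hasSum_apply w)
    have h2 : HasSum (fun k => inner ℂ (g.coeff k) (f.coeff k)) (inner ℂ g f) :=
      lp.hasSum_inner (𝕜 := ℂ) (G := fun _ : Fin n → ℕ => E) g f
    refine h1.unique (h2.congr_fun fun k => ?_)
    rw [hg, inner_smul_left, inner_smul_right, RCLike.conj_conj]
  rw [hk]
  have hzw : (fun i => z.1 i * starRingEnd ℂ (w.1 i)) ∈ Polydisc n := fun i => by
    rw [norm_mul, RCLike.norm_conj]
    exact mul_lt_one_of_nonneg_of_lt_one_left (norm_nonneg _) (z.2 i) (w.2 i).le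
  have h3 := ((hasSum_monomialAt hzw).1).smul_const η
  refine (g.hasSum_apply z).unique ?_
  refine h3.congr_fun fun k => ?_
  rw [hg, smul_smul]
  congr 1
  simp [monomialAt, mul_pow, Finset.prod_mul_distrib]

end Functions

end HardySpace

section Operators

variable {n : ℕ} {E F : Type*} [NormedAddCommGroup E] [InnerProductSpace ℂ E] [CompleteSpace E]
  [NormedAddCommGroup F] [InnerProductSpace ℂ F] [CompleteSpace F]

/-- `Φ` is a multiplier: the pointwise product `Φ f` is in `H²_F(𝔻ⁿ)` for all `f ∈ H²_E(𝔻ⁿ)`. -/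
def IsMultiplier (Φ : Polydisc n → E →L[ℂ] F) : Prop :=
  ∀ f : HardySpace n E, ∃ g : HardySpace n F, ∀ z, g z = Φ z (f z)

/-- The multiplication operator `M_Φ : H²_E(𝔻ⁿ) → H²_F(𝔻ⁿ)`, `(M_Φ f)(z) = Φ(z) f(z)`
(bounded by the closed graph theorem). -/
noncomputable def mulOp (Φ : Polydisc n → E →L[ℂ] F) (hΦ : IsMultiplier Φ) :
    HardySpace n E →L[ℂ] HardySpace n F :=
  ContinuousLinearMap.ofSeqClosedGraph
    (g := { toFun := fun f => (hΦ f).choose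
            map_add' := fun f g => RKHS.ext fun z => by
              refine ((hΦ (f + g)).choose_spec z).trans ?_
              rw [RKHS.coe_add f g, Pi.add_apply, map_add, ← (hΦ f).choose_spec,
                ← (hΦ g).choose_spec, ← Pi.add_apply, ← RKHS.coe_add]
            map_smul' := fun c f => RKHS.ext fun z => by
              refine ((hΦ (c • f)).choose_spec z).trans ?_
              rw [RingHom.id_apply, RKHS.coe_smul f c, Pi.smul_apply, map_smul,
                ← (hΦ f).choose_spec, ← Pi.smul_apply, ← RKHS.coe_smul] })
    (by
      intro u x y hu hy
      refine RKHS.ext fun z => ?_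
      have h1 := ((RKHS.continuous_eval (H := HardySpace n F) z).tendsto y).comp hy
      have h2 := ((Φ z).continuous.tendsto (x z)).comp
        (((RKHS.continuous_eval (H := HardySpace n E) z).tendsto x).comp hu)
      refine tendsto_nhds_unique h1 ?_
      change Filter.Tendsto _ _ (nhds ((hΦ x).choose z))
      rw [(hΦ x).choose_spec]
      exact h2.congr fun m => ((hΦ (u m)).choose_spec z).symm)

theorem mulOp_apply (Φ : Polydisc n → E →L[ℂ] F) (hΦ : IsMultiplier Φ) (f : HardySpace n E)
    (z : Polydisc n) : mulOp Φ hΦ f z = Φ z (f z) :=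
  (hΦ f).choose_spec z

theorem isMultiplier_const (T : E →L[ℂ] F) : IsMultiplier fun _ : Polydisc n => T := by
  intro f
  have hmem : Memℓp (fun k : Fin n → ℕ => T (f.coeff k)) 2 := by
    have hf : Memℓp (fun k : Fin n → ℕ => f.coeff k) 2 :=
      lp.memℓp (E := fun _ : Fin n → ℕ => E) f
    refine memℓp_gen ?_
    refine Summable.of_nonneg_of_le (fun _ => by positivity) (fun k => ?_)
      ((hf.summable (by norm_num)).mul_left (‖T‖ ^ (2 : ENNReal).toReal))
    rw [← Real.mul_rpow (norm_nonneg _) (norm_nonneg _)]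
    exact Real.rpow_le_rpow (norm_nonneg _) (T.le_opNorm _) (by norm_num)
  refine ⟨HardySpace.ofCoeff ⟨_, hmem⟩, fun z => ?_⟩
  refine (HardySpace.hasSum_apply _ z).unique ((T.hasSum (f.hasSum_apply z)).congr_fun fun k => ?_)
  rw [map_smul]
  rfl

theorem isMultiplier_coord (i : Fin n) :
    IsMultiplier fun z : Polydisc n => z.1 i • ContinuousLinearMap.id ℂ E := by
  intro f
  have hinj : Function.Injective fun k : Fin n → ℕ => k + Pi.single i 1 :=
    add_left_injective _
  let b : (Fin n → ℕ) → E := Function.extend (fun k => k + Pi.single i 1) f.coeff 0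
  have hb : ∀ k, b (k + Pi.single i 1) = f.coeff k := fun k => hinj.extend_apply f.coeff 0 k
  have hb0 : ∀ k ∉ Set.range fun k : Fin n → ℕ => k + Pi.single i 1, b k = 0 := fun k hk =>
    Function.extend_apply' _ _ _ hk
  have hmem : Memℓp b 2 := by
    have hf : Memℓp (fun k : Fin n → ℕ => f.coeff k) 2 :=
      lp.memℓp (E := fun _ : Fin n → ℕ => E) f
    refine memℓp_gen ((hinj.summable_iff fun k hk => ?_).mp ?_)
    · rw [hb0 k hk]; norm_num
    · refine (hf.summable (by norm_num)).congr fun k => ?_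
      simp only [Function.comp_apply, hb]
  refine ⟨HardySpace.ofCoeff ⟨b, hmem⟩, fun z => ?_⟩
  have h1 : HasSum (fun k => monomialAt z.1 k • b k) ((HardySpace.ofCoeff ⟨b, hmem⟩) z) :=
    HardySpace.hasSum_apply (HardySpace.ofCoeff ⟨b, hmem⟩) z
  rw [← hinj.hasSum_iff fun k hk => by rw [hb0 k hk, smul_zero]] at h1
  refine h1.unique (((f.hasSum_apply z).const_smul (z.1 i)).congr_fun fun k => ?_)
  simp only [Function.comp_apply, hb, smul_smul]
  congr 1
  have : ∏ j, z.1 j ^ (Pi.single i 1 : Fin n → ℕ) j = z.1 i := by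
    rw [Finset.prod_eq_single i] <;> simp +contextual
  simp only [monomialAt, Pi.add_apply, pow_add, Finset.prod_mul_distrib, this]
  ring

variable (E) in
/-- The multiplication operator `M_{zᵢ}` on `H²_E(𝔻ⁿ)`. -/
noncomputable def coordOp (i : Fin n) : HardySpace n E →L[ℂ] HardySpace n E :=
  mulOp (fun z => z.1 i • ContinuousLinearMap.id ℂ E) (isMultiplier_coord i)

variable (E) in
/-- The multiplication operator `M_z` on `H²_E(𝔻)`. -/
noncomputable def Mz : HardySpace 1 E →L[ℂ] HardySpace 1 E := coordOp E 0

variable (E) in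
/-- The constant function `κᵢ(w) = M_{zᵢ} ∈ B(E_n)` on `𝔻`, where `E_n = H²_E(𝔻ⁿ)`. -/
noncomputable def kappa (i : Fin n) (_w : Polydisc 1) : HardySpace n E →L[ℂ] HardySpace n E :=
  coordOp E i

variable (E) in
/-- The multiplication operator `M_{κᵢ}` on `H²_{E_n}(𝔻)`. -/
noncomputable def Mkappa (i : Fin n) :
    HardySpace 1 (HardySpace n E) →L[ℂ] HardySpace 1 (HardySpace n E) :=
  mulOp (kappa E i) (isMultiplier_const _)

/-- `Φ ∈ H^∞_{B(E)}(𝔻)`: `Φ` is a bounded analytic `B(E)`-valued function on the disc. -/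
def MemHInfty (Φ : ℂ → E →L[ℂ] E) : Prop :=
  AnalyticOnNhd ℂ Φ (Metric.ball 0 1) ∧ ∃ C : ℝ, ∀ w ∈ Metric.ball (0 : ℂ) 1, ‖Φ w‖ ≤ C

/-- A function of one complex variable as a function on `𝔻 = 𝔻¹`. -/
def onDisc (Φ : ℂ → E →L[ℂ] E) : Polydisc 1 → E →L[ℂ] E := fun w => Φ (w.1 0)

instance (S : ClosedSubmodule ℂ E) : CompleteSpace S.toSubmodule :=
  S.isClosed.completeSpace_coe

/-- The wandering subspace `W = S ⊖ VS` of an operator `V` on `S`. -/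
noncomputable def wandering (V : E →L[ℂ] E) : Submodule ℂ E := V.rangeᗮ

instance (V : E →L[ℂ] E) : CompleteSpace (wandering V) :=
  inferInstanceAs (CompleteSpace V.rangeᗮ)

/-- The operator `P_S M_z^*` on a closed subspace `S` of `H²_E(𝔻)`. -/
noncomputable def compressedAdjoint (S : Submodule ℂ (HardySpace 1 E)) [CompleteSpace S] :
    S →L[ℂ] S :=
  S.orthogonalProjectionOnto ∘L (ContinuousLinearMap.adjoint (Mz E)) ∘L S.subtypeL

/-- `Φ(w) = P_W (I_S - w P_S M_z^*)⁻¹ C|_W`, for a closed subspace `W` of `S` and an operator `C`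
on `S`. -/
noncomputable def symbol (S : Submodule ℂ (HardySpace 1 E)) [CompleteSpace S]
    (W : Submodule ℂ S) [CompleteSpace W] (C : S →L[ℂ] S) (w : ℂ) : W →L[ℂ] W :=
  W.orthogonalProjectionOnto ∘L Ring.inverse (1 - w • compressedAdjoint S) ∘L C.domRestrict W

end Operators

/-- Unitary equivalence of two tuples of operators on Hilbert spaces. -/
def UnitarilyEquivalent {ι H K : Type*} [NormedAddCommGroup H] [InnerProductSpace ℂ H]
    [NormedAddCommGroup K] [InnerProductSpace ℂ K] (A : ι → H →L[ℂ] H) (B : ι → K →L[ℂ] K) :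
    Prop :=
  ∃ U : H ≃ₗᵢ[ℂ] K, ∀ j x, U (A j x) = B j (U x)

section InvariantSubspace

variable {n : ℕ} {E : Type*} [NormedAddCommGroup E] [InnerProductSpace ℂ E] [CompleteSpace E]

/-- The closed subspace `S` of `H²_{E_n}(𝔻)` is invariant for `(M_z, M_{κ₁}, …, M_{κₙ})`. -/
def IsInvariantSubspace (S : ClosedSubmodule ℂ (HardySpace 1 (HardySpace n E))) : Prop :=
  (∀ f ∈ S.toSubmodule, Mz (HardySpace n E) f ∈ S.toSubmodule) ∧
    ∀ i : Fin n, ∀ f ∈ S.toSubmodule, Mkappa E i f ∈ S.toSubmodule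

variable {S : ClosedSubmodule ℂ (HardySpace 1 (HardySpace n E))}

namespace IsInvariantSubspace

/-- `M_z|_S`. -/
noncomputable def restrictMz (hS : IsInvariantSubspace S) : S.toSubmodule →L[ℂ] S.toSubmodule :=
  (Mz (HardySpace n E)).restrict hS.1

/-- `M_{κᵢ}|_S`. -/
noncomputable def restrictMkappa (hS : IsInvariantSubspace S) (i : Fin n) :
    S.toSubmodule →L[ℂ] S.toSubmodule :=
  (Mkappa E i).restrict (hS.2 i)

/-- The tuple `(M_z|_S, M_{κ₁}|_S, …, M_{κₙ}|_S)`. -/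
noncomputable def restrictTuple (hS : IsInvariantSubspace S) :
    Fin (n + 1) → S.toSubmodule →L[ℂ] S.toSubmodule :=
  Fin.cons hS.restrictMz hS.restrictMkappa

/-- `W = S ⊖ zS`, as a subspace of `S`. -/
noncomputable abbrev W (hS : IsInvariantSubspace S) : Submodule ℂ S.toSubmodule :=
  wandering hS.restrictMz

/-- `Φᵢ(w) = P_W (I_S - w P_S M_z^*)⁻¹ M_{κᵢ}|_W`. -/
noncomputable def Phi (hS : IsInvariantSubspace S) (i : Fin n) : ℂ → hS.W →L[ℂ] hS.W :=
  symbol S.toSubmodule hS.W (hS.restrictMkappa i)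

/-- The tuple `(M_z, M_{Φ₁}, …, M_{Φₙ})` on `H²_W(𝔻)`. -/
noncomputable def modelTuple (hS : IsInvariantSubspace S)
    (hΦ : ∀ i, IsMultiplier (onDisc (hS.Phi i))) :
    Fin (n + 1) → HardySpace 1 hS.W →L[ℂ] HardySpace 1 hS.W :=
  Fin.cons (Mz hS.W) fun i => mulOp (onDisc (hS.Phi i)) (hΦ i)

end IsInvariantSubspace

end InvariantSubspace

/-!
The operator `V = M_z|_S` is an isometry, and it is pure: `V^{*m} = P_S M_z^{*m}|_S → 0` strongly,
because `‖M_z^{*m} f‖²` is a tail of the series for `‖f‖²`. By the Wold decomposition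
(`exists_wold_model`), `x ↦ (w ↦ P_W (I - w V^*)⁻¹ x)` is a unitary from `S` onto `H²_W(𝔻)`, where
`W = S ⊖ V S`. It is isometric because `P_W = I - V V^*` makes `∑ ‖P_W V^{*m} x‖²` telescope, and
onto because its range contains every kernel function of `H²_W(𝔻)`
(`exists_wanderingEval_eq`).

Write `L_w = P_W (I - w V^*)⁻¹` (`wanderingEval`). From `V^* V = I` and `P_W V = 0` one gets
`L_w V = w L_w`, so the unitary turns `V` into `M_z`. If `C` commutes with `V`, a purely algebraic
computation gives `L_w C x = L_w C (L_w x)` (`wanderingEval_apply_commute`), so the same unitary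
turns `C` into multiplication by `Φ(w) = L_w C|_W`. For `C = M_{κᵢ}|_S` this is `Φᵢ`, which is
therefore a multiplier. Its values are bounded by the norm of `M_{Φᵢ}`
(`HardySpace.norm_apply_le_norm_mulOp`), by testing on kernel functions, and it is analytic because
the resolvent is.
-/

open ContinuousLinearMap Filter Topology

/-! ### Coefficients of functions in the Hardy space -/

namespace HardySpace

section Norm

theorem memℓp_two_of_summable {n : ℕ} {E : Type*} [NormedAddCommGroup E] {a : (Fin n → ℕ) → E}
    (h : Summable fun k => ‖a k‖ ^ 2) : Memℓp a 2 :=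
  memℓp_gen (by norm_num; exact h)

variable {n : ℕ} {E : Type*} [NormedAddCommGroup E] [InnerProductSpace ℂ E]

theorem hasSum_sq_norm_coeff (f : HardySpace n E) :
    HasSum (fun k => ‖f.coeff k‖ ^ 2) (‖f‖ ^ 2) := by
  have h := lp.hasSum_norm (E := fun _ : Fin n → ℕ => E) (p := 2) (by norm_num) f
  norm_num at h
  exact h

theorem hasSum_inner_coeff (f g : HardySpace n E) :
    HasSum (fun k => inner ℂ (f.coeff k) (g.coeff k)) (inner ℂ f g) :=
  lp.hasSum_inner (𝕜 := ℂ) (G := fun _ : Fin n → ℕ => E) f g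

end Norm

variable {n : ℕ} {E F : Type*} [NormedAddCommGroup E] [InnerProductSpace ℂ E] [CompleteSpace E]
  [NormedAddCommGroup F] [InnerProductSpace ℂ F] [CompleteSpace F]

/-- A square summable sequence which sums to the values of `f` consists of the Taylor
coefficients of `f`. -/
theorem coeff_eq_of_hasSum {f : HardySpace n E} {a : (Fin n → ℕ) → E}
    (ha : Summable fun k => ‖a k‖ ^ 2)
    (h : ∀ z : Polydisc n, HasSum (fun k => monomialAt z.1 k • a k) (f z)) : f.coeff = a := by
  have : f = ofCoeff ⟨a, memℓp_two_of_summable ha⟩ := RKHS.ext fun z =>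
    (h z).unique (hasSum_apply (ofCoeff ⟨a, memℓp_two_of_summable ha⟩) z)
  rw [this]
  rfl

theorem coeff_mulOp_const (T : E →L[ℂ] F) (f : HardySpace n E) (k : Fin n → ℕ) :
    (mulOp (fun _ => T) (isMultiplier_const T) f).coeff k = T (f.coeff k) := by
  refine congrFun (coeff_eq_of_hasSum (a := fun k => T (f.coeff k)) ?_ fun z => ?_) k
  · refine Summable.of_nonneg_of_le (fun _ => by positivity) (fun k => ?_)
      (f.hasSum_sq_norm_coeff.summable.mul_left (‖T‖ ^ 2))
    rw [← mul_pow]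
    exact pow_le_pow_left₀ (norm_nonneg _) (T.le_opNorm _) 2
  · rw [mulOp_apply]
    exact (T.hasSum (f.hasSum_apply z)).congr_fun fun k => by
      rw [map_smul]

theorem norm_mulOp_const_apply {T : E →L[ℂ] F} (hT : Isometry T) (f : HardySpace n E) :
    ‖mulOp (fun _ => T) (isMultiplier_const T) f‖ = ‖f‖ := by
  refine (sq_eq_sq₀ (norm_nonneg _) (norm_nonneg _)).mp
    (HasSum.unique (hasSum_sq_norm_coeff _) (f.hasSum_sq_norm_coeff.congr_fun fun k => ?_))
  rw [coeff_mulOp_const, hT.norm_map_of_map_zero (map_zero T)]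

theorem coordOp_apply (i : Fin n) (f : HardySpace n E) (z : Polydisc n) :
    coordOp E i f z = z.1 i • f z := by
  rw [coordOp, mulOp_apply]
  rfl

/-- Multiplication by `zᵢ` shifts the Taylor coefficients in the direction `i`. -/
theorem coeff_coordOp (i : Fin n) (f : HardySpace n E) :
    (coordOp E i f).coeff =
      Function.extend (fun k : Fin n → ℕ => k + Pi.single i 1) f.coeff 0 := by
  have hinj : Function.Injective fun k : Fin n → ℕ => k + Pi.single i 1 :=
    add_left_injective _
  refine coeff_eq_of_hasSum ((hinj.summable_iff fun k hk => ?_).mp ?_) fun z =>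
    (hinj.hasSum_iff fun k hk => ?_).mp ?_
  · rw [Function.extend_apply' _ _ _ hk]
    simp
  · refine f.hasSum_sq_norm_coeff.summable.congr fun k => ?_
    rw [Function.comp_apply, hinj.extend_apply]
  · rw [Function.extend_apply' _ _ _ hk, Pi.zero_apply, smul_zero]
  · rw [coordOp_apply]
    refine ((f.hasSum_apply z).const_smul (z.1 i)).congr_fun fun k => ?_
    rw [Function.comp_apply, hinj.extend_apply, smul_smul]
    congr 1
    have : ∏ j, z.1 j ^ (Pi.single i 1 : Fin n → ℕ) j = z.1 i := by
      rw [Finset.prod_eq_single i] <;> simp +contextual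
    simp only [monomialAt, Pi.add_apply, pow_add, Finset.prod_mul_distrib, this]
    ring

theorem coeff_coordOp_add_single (i : Fin n) (f : HardySpace n E) (k : Fin n → ℕ) :
    (coordOp E i f).coeff (k + Pi.single i 1) = f.coeff k := by
  rw [coeff_coordOp]
  exact (add_left_injective (Pi.single i 1 : Fin n → ℕ)).extend_apply f.coeff 0 k

/-- A series in the Taylor coefficients of `zᵢ f` is a series in those of `f`: the coefficients of
`zᵢ f` at exponents outside `ℤ₊ⁿ + eᵢ` vanish. -/
theorem hasSum_coordOp {α : Type*} [AddCommMonoid α] [TopologicalSpace α] (i : Fin n)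
    (f : HardySpace n E) {φ : (Fin n → ℕ) → E → α} (hφ : ∀ k, φ k 0 = 0) {a : α} :
    HasSum (fun k => φ k ((coordOp E i f).coeff k)) a ↔
      HasSum (fun k => φ (k + Pi.single i 1) (f.coeff k)) a := by
  have hinj : Function.Injective fun k : Fin n → ℕ => k + Pi.single i 1 :=
    add_left_injective _
  rw [← hinj.hasSum_iff fun k hk => ?_]
  · simp only [Function.comp_def, coeff_coordOp_add_single]
  · rw [coeff_coordOp, Function.extend_apply' _ _ _ hk, Pi.zero_apply, hφ]

theorem isometry_coordOp (i : Fin n) : Isometry (coordOp E i) := by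
  refine AddMonoidHomClass.isometry_of_norm _ fun f => ?_
  refine (sq_eq_sq₀ (norm_nonneg _) (norm_nonneg _)).mp (HasSum.unique (hasSum_sq_norm_coeff _) ?_)
  rw [hasSum_coordOp i f (φ := fun _ a => ‖a‖ ^ 2) (by simp)]
  exact f.hasSum_sq_norm_coeff

theorem coeff_adjoint_coordOp (i : Fin n) (f : HardySpace n E) (k : Fin n → ℕ) :
    (adjoint (coordOp E i) f).coeff k = f.coeff (k + Pi.single i 1) := by
  have ha : Summable fun k => ‖f.coeff (k + Pi.single i 1)‖ ^ 2 :=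
    f.hasSum_sq_norm_coeff.summable.comp_injective
      (add_left_injective (Pi.single i 1 : Fin n → ℕ))
  have : adjoint (coordOp E i) f = ofCoeff ⟨_, memℓp_two_of_summable ha⟩ := by
    refine ext_inner_right ℂ fun g => ?_
    rw [adjoint_inner_left]
    have h := hasSum_inner_coeff f (coordOp E i g)
    rw [hasSum_coordOp i g (φ := fun k a => inner ℂ (f.coeff k) a) (by simp)] at h
    exact h.unique (hasSum_inner_coeff (ofCoeff ⟨_, memℓp_two_of_summable ha⟩) g)
  rw [this]
  rfl

/-- Series over the exponents of one variable are series over `ℕ`. -/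
theorem hasSum_one_variable {α : Type*} [AddCommMonoid α] [TopologicalSpace α]
    {φ : (Fin 1 → ℕ) → α} {a : α} :
    HasSum (fun m : ℕ => φ fun _ => m) a ↔ HasSum φ a :=
  (Equiv.funUnique (Fin 1) ℕ).symm.hasSum_iff

/-- The backward shift `M_z^*` on `H²_E(𝔻)` is pure: its powers tend strongly to `0`, as
`‖M_z^{*m} f‖²` is the tail of the series for `‖f‖²`. -/
theorem tendsto_adjoint_Mz_pow (f : HardySpace 1 E) :
    Tendsto (fun m : ℕ => (adjoint (Mz E) ^ m) f) atTop (𝓝 0) := by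
  have hc : ∀ m j : ℕ, ((adjoint (Mz E) ^ m) f).coeff (fun _ => j) = f.coeff fun _ => j + m := by
    intro m
    induction m with
    | zero => intro j; rfl
    | succ m ih =>
      intro j
      rw [pow_succ', ContinuousLinearMap.mul_def, comp_apply, Mz, coeff_adjoint_coordOp, ← Mz]
      have : (fun _ : Fin 1 => j) + Pi.single 0 1 = fun _ => j + 1 := by
        funext i
        simp [Subsingleton.elim i 0]
      rw [this, ih]
      congr 1
      funext
      ring
  have hn : ∀ m, ‖(adjoint (Mz E) ^ m) f‖ ^ 2 = ∑' j : ℕ, ‖f.coeff fun _ => j + m‖ ^ 2 := by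
    intro m
    have h := hasSum_one_variable.mpr (hasSum_sq_norm_coeff ((adjoint (Mz E) ^ m) f))
    simp only [hc] at h
    exact h.tsum_eq.symm
  have ht := tendsto_sum_nat_add fun j : ℕ => ‖f.coeff fun _ => j‖ ^ 2
  rw [tendsto_zero_iff_norm_tendsto_zero]
  have := ht.congr fun m => (hn m).symm
  simpa using this.sqrt

/-! ### Reproducing kernel estimates -/

/-- The diagonal value `∏ᵢ (1 - |zᵢ|²)⁻¹` of the Szegő kernel. -/
noncomputable def szegoDiag (z : Polydisc n) : ℝ := ∏ i, (1 - ‖z.1 i‖ ^ 2)⁻¹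

theorem szegoDiag_pos (z : Polydisc n) : 0 < szegoDiag z := by
  refine Finset.prod_pos fun i _ => inv_pos.mpr ?_
  have := z.2 i
  nlinarith [norm_nonneg (z.1 i)]

theorem kerFun_apply_self (z : Polydisc n) (v : E) :
    RKHS.kerFun (HardySpace n E) z v z = (szegoDiag z : ℂ) • v := by
  have hz : ∀ i, z.1 i * starRingEnd ℂ (z.1 i) = ((‖z.1 i‖ ^ 2 : ℝ) : ℂ) := fun i => by
    rw [Complex.mul_conj, Complex.normSq_eq_norm_sq]
  rw [RKHS.kerFun_apply, kernel_HardySpace]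
  simp only [hz, szegoDiag]
  push_cast
  rfl

theorem norm_kerFun (z : Polydisc n) (v : E) :
    ‖RKHS.kerFun (HardySpace n E) z v‖ = √(szegoDiag z) * ‖v‖ := by
  have h := RKHS.kerFun_inner z v (RKHS.kerFun (HardySpace n E) z v)
  rw [kerFun_apply_self, inner_smul_right, inner_self_eq_norm_sq_to_K,
    inner_self_eq_norm_sq_to_K] at h
  have h' : ‖RKHS.kerFun (HardySpace n E) z v‖ ^ 2 = szegoDiag z * ‖v‖ ^ 2 :=
    Complex.ofReal_injective (by push_cast; exact h)
  rw [← Real.sqrt_sq (norm_nonneg (RKHS.kerFun (HardySpace n E) z v)), h',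
    Real.sqrt_mul (szegoDiag_pos z).le, Real.sqrt_sq (norm_nonneg v)]

/-- The values of a multiplier are bounded by the norm of the multiplication operator. -/
theorem norm_apply_le_norm_mulOp (Φ : Polydisc n → E →L[ℂ] F) (hΦ : IsMultiplier Φ)
    (z : Polydisc n) : ‖Φ z‖ ≤ ‖mulOp Φ hΦ‖ := by
  refine opNorm_le_bound _ (norm_nonneg _) fun v => ?_
  have hc := szegoDiag_pos z
  -- Pair `M_Φ k_z v` with `k_z Φ(z) v`, where `k_z` is the kernel function at `z`.
  have h := RKHS.kerFun_inner z (Φ z v) (mulOp Φ hΦ (RKHS.kerFun (HardySpace n E) z v))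
  rw [mulOp_apply, kerFun_apply_self, map_smul, inner_smul_right,
    inner_self_eq_norm_sq_to_K] at h
  have h1 : szegoDiag z * ‖Φ z v‖ ^ 2 =
      ‖inner ℂ (RKHS.kerFun (HardySpace n F) z (Φ z v))
        (mulOp Φ hΦ (RKHS.kerFun (HardySpace n E) z v))‖ := by
    rw [h]
    simp [abs_of_pos hc]
  have h2 : szegoDiag z * ‖Φ z v‖ ^ 2 ≤
      szegoDiag z * (‖Φ z v‖ * (‖mulOp Φ hΦ‖ * ‖v‖)) := by
    rw [h1]
    refine (norm_inner_le_norm _ _).trans ((mul_le_mul_of_nonneg_left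
      ((mulOp Φ hΦ).le_opNorm _) (norm_nonneg _)).trans_eq ?_)
    rw [norm_kerFun, norm_kerFun]
    nth_rewrite 3 [← Real.mul_self_sqrt hc.le]
    ring
  have h3 := le_of_mul_le_mul_left h2 hc
  rcases (norm_nonneg (Φ z v)).eq_or_lt with h0 | h0
  · rw [← h0]
    positivity
  · rw [sq] at h3
    exact le_of_mul_le_mul_left h3 h0

end HardySpace

/-! ### The Wold model of a pure isometry -/

section Wold

variable {H : Type*} [NormedAddCommGroup H] [InnerProductSpace ℂ H] [CompleteSpace H]
  {V : H →L[ℂ] H}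

theorem adjoint_apply_of_isometry (hV : Isometry V) (x : H) : adjoint V (V x) = x :=
  DFunLike.congr_fun ((isometry_iff_adjoint_comp_self V).mp hV) x

theorem adjoint_apply_of_mem_wandering {η : H} (hη : η ∈ wandering V) : adjoint V η = 0 := by
  rwa [wandering, orthogonal_range] at hη

theorem orthogonalProjectionOnto_wandering_apply_range (x : H) :
    (wandering V).orthogonalProjectionOnto (V x) = 0 := by
  rw [Submodule.orthogonalProjectionOnto_eq_zero_iff]
  exact Submodule.le_orthogonal_orthogonal _ ⟨x, rfl⟩

/-- The projection onto the wandering subspace of an isometry is `I - V V^*`. -/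
theorem coe_orthogonalProjectionOnto_wandering (hV : Isometry V) (x : H) :
    ((wandering V).orthogonalProjectionOnto x : H) = x - V (adjoint V x) := by
  have hm : x - V (adjoint V x) ∈ wandering V := by
    rw [wandering, orthogonal_range, LinearMap.mem_ker]
    change adjoint V (x - V (adjoint V x)) = 0
    rw [map_sub, adjoint_apply_of_isometry hV, sub_self]
  have h : (wandering V).orthogonalProjectionOnto (x - V (adjoint V x)) = ⟨_, hm⟩ :=
    Submodule.orthogonalProjectionOnto_mem_subspace_eq_self (⟨_, hm⟩ : wandering V)
  rw [map_sub, orthogonalProjectionOnto_wandering_apply_range, sub_zero] at h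
  rw [h]

theorem norm_sq_orthogonalProjectionOnto_wandering (hV : Isometry V) (x : H) :
    ‖(wandering V).orthogonalProjectionOnto x‖ ^ 2 = ‖x‖ ^ 2 - ‖adjoint V x‖ ^ 2 := by
  rw [← Submodule.norm_coe, coe_orthogonalProjectionOnto_wandering hV, @norm_sub_sq ℂ,
    ← adjoint_inner_left, inner_self_eq_norm_sq, hV.norm_map_of_map_zero (map_zero V)]
  ring

/-- The Pythagorean identities for `V^{*m} x` telescope. -/
theorem hasSum_sq_norm_wandering (hV : Isometry V) {x : H}
    (hx : Tendsto (fun m : ℕ => (adjoint V ^ m) x) atTop (𝓝 0)) :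
    HasSum (fun m : ℕ => ‖(wandering V).orthogonalProjectionOnto ((adjoint V ^ m) x)‖ ^ 2)
      (‖x‖ ^ 2) := by
  rw [hasSum_iff_tendsto_nat_of_nonneg fun _ => by positivity]
  have h : ∀ N : ℕ, ∑ m ∈ Finset.range N,
      ‖(wandering V).orthogonalProjectionOnto ((adjoint V ^ m) x)‖ ^ 2 =
        ‖x‖ ^ 2 - ‖(adjoint V ^ N) x‖ ^ 2 := by
    intro N
    induction N with
    | zero => simp
    | succ N ih =>
      rw [Finset.sum_range_succ, ih, norm_sq_orthogonalProjectionOnto_wandering hV, pow_succ' (adjoint V),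
        ContinuousLinearMap.mul_def, comp_apply]
      ring
  simp only [h]
  simpa using (hx.norm.pow 2).const_sub (‖x‖ ^ 2)

variable (V) in
/-- The operator `x ↦ P_W (I - w V^*)⁻¹ x` from `H` to the wandering subspace `W` of `V`. It is
the value at `w` of the function that represents `x` in the Wold model of `V`. -/
noncomputable def wanderingEval (w : ℂ) : H →L[ℂ] wandering V :=
  (wandering V).orthogonalProjectionOnto ∘L Ring.inverse (1 - w • adjoint V)

theorem norm_adjoint_le_one (hV : Isometry V) : ‖adjoint V‖ ≤ 1 := by
  rw [LinearIsometryEquiv.norm_map]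
  exact opNorm_le_bound _ zero_le_one fun x => by
    rw [hV.norm_map_of_map_zero (map_zero V), one_mul]

theorem norm_smul_adjoint_lt_one (hV : Isometry V) {w : ℂ} (hw : ‖w‖ < 1) :
    ‖w • adjoint V‖ < 1 := by
  rw [norm_smul]
  exact mul_lt_one_of_nonneg_of_lt_one_left (norm_nonneg _) hw (norm_adjoint_le_one hV)

theorem isUnit_one_sub_smul_adjoint (hV : Isometry V) {w : ℂ} (hw : ‖w‖ < 1) :
    IsUnit (1 - w • adjoint V) :=
  isUnit_one_sub_of_norm_lt_one (norm_smul_adjoint_lt_one hV hw)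

theorem analyticOnNhd_wanderingEval (hV : Isometry V) :
    AnalyticOnNhd ℂ (wanderingEval V) (Metric.ball 0 1) := by
  intro w hw
  have hinv : AnalyticAt ℂ (fun w : ℂ => Ring.inverse (1 - w • adjoint V)) w := by
    obtain ⟨u, hu⟩ := isUnit_one_sub_smul_adjoint hV (mem_ball_zero_iff.mp hw)
    refine AnalyticAt.fun_comp (hu ▸ analyticAt_inverse (𝕜 := ℂ) u) ?_
    exact analyticAt_const.sub (analyticAt_id.smul analyticAt_const)
  exact ((compL ℂ H H (wandering V) (wandering V).orthogonalProjectionOnto).analyticAt _).comp hinv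

theorem wanderingEval_sub (hV : Isometry V) {w : ℂ} (hw : ‖w‖ < 1) (x : H) :
    wanderingEval V w (x - w • adjoint V x) = (wandering V).orthogonalProjectionOnto x := by
  have h := DFunLike.congr_fun
    (Ring.inverse_mul_cancel _ (isUnit_one_sub_smul_adjoint hV hw)) x
  exact congrArg (wandering V).orthogonalProjectionOnto h

theorem exists_sub_smul_adjoint_eq (hV : Isometry V) {w : ℂ} (hw : ‖w‖ < 1) (x : H) :
    ∃ y, y - w • adjoint V y = x :=
  ⟨_, DFunLike.congr_fun (Ring.mul_inverse_cancel _ (isUnit_one_sub_smul_adjoint hV hw)) x⟩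

theorem wanderingEval_coe (hV : Isometry V) {w : ℂ} (hw : ‖w‖ < 1) (η : wandering V) :
    wanderingEval V w η = η := by
  have h := wanderingEval_sub hV hw (η : H)
  rwa [adjoint_apply_of_mem_wandering η.2, smul_zero, sub_zero,
    Submodule.orthogonalProjectionOnto_mem_subspace_eq_self] at h

/-- The Wold model turns `V` into multiplication by the coordinate. -/
theorem wanderingEval_apply_range (hV : Isometry V) {w : ℂ} (hw : ‖w‖ < 1) (x : H) :
    wanderingEval V w (V x) = w • wanderingEval V w x := by
  have h := wanderingEval_sub hV hw (V x)
  rwa [adjoint_apply_of_isometry hV, orthogonalProjectionOnto_wandering_apply_range, map_sub,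
    map_smul, sub_eq_zero] at h

/-- The Wold model turns an operator `C` that commutes with `V` into multiplication by the
operator valued function `w ↦ P_W (I - w V^*)⁻¹ C|_W`. -/
theorem wanderingEval_apply_commute (hV : Isometry V) {C : H →L[ℂ] H} (hC : Commute C V) {w : ℂ}
    (hw : ‖w‖ < 1) (x : H) :
    wanderingEval V w (C x) = wanderingEval V w (C (wanderingEval V w x : H)) := by
  have hL : ∀ y, wanderingEval V w (C (V y)) = w • wanderingEval V w (C y) := fun y => by
    rw [← wanderingEval_apply_range hV hw]
    exact congrArg (wanderingEval V w) (DFunLike.congr_fun hC y)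
  -- Writing `x = y - w V^* y` gives `P_W (I - w V^*)⁻¹ x = y - V V^* y`, and `hL` shows that
  -- `V V^* y` and `w V^* y` contribute equally.
  obtain ⟨y, rfl⟩ := exists_sub_smul_adjoint_eq hV hw x
  rw [wanderingEval_sub hV hw, coe_orthogonalProjectionOnto_wandering hV, map_sub, map_sub,
    map_sub, map_sub, hL, map_smul, map_smul]

theorem hasSum_wanderingEval (hV : Isometry V) {w : ℂ} (hw : ‖w‖ < 1) (x : H) :
    HasSum (fun m : ℕ => w ^ m • (wandering V).orthogonalProjectionOnto ((adjoint V ^ m) x))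
      (wanderingEval V w x) := by
  have hT := norm_smul_adjoint_lt_one hV hw
  have h := (summable_geometric_of_norm_lt_one hT).hasSum
  rw [geom_series_eq_inverse _ hT] at h
  have h' := (wandering V).orthogonalProjectionOnto.hasSum
    ((ContinuousLinearMap.apply ℂ H x).hasSum h)
  refine h'.congr_fun fun m => ?_
  simp [smul_pow]

/-- The kernel functions of the Wold model: they are images of the vectors
`(I - w̄ V)⁻¹ η` with `η` in the wandering subspace. -/
theorem exists_wanderingEval_eq (hV : Isometry V) {w : ℂ} (hw : ‖w‖ < 1) (η : wandering V) :
    ∃ x : H, ∀ z : ℂ, ‖z‖ < 1 →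
      wanderingEval V z x = (1 - z * starRingEnd ℂ w)⁻¹ • η := by
  have hT : ‖starRingEnd ℂ w • V‖ < 1 := by
    rw [norm_smul, RCLike.norm_conj, ← LinearIsometryEquiv.norm_map (adjoint (𝕜 := ℂ)) V]
    exact mul_lt_one_of_nonneg_of_lt_one_left (norm_nonneg _) hw (norm_adjoint_le_one hV)
  have h := DFunLike.congr_fun
    (Ring.mul_inverse_cancel _ (isUnit_one_sub_of_norm_lt_one hT)) (η : H)
  refine ⟨Ring.inverse (1 - starRingEnd ℂ w • V) η, fun z hz => ?_⟩
  generalize Ring.inverse (1 - starRingEnd ℂ w • V) = R at h ⊢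
  change R η - starRingEnd ℂ w • V (R η) = η at h
  have h0 : 1 - z * starRingEnd ℂ w ≠ 0 := by
    intro h0
    have : ‖z * starRingEnd ℂ w‖ < 1 := by
      rw [norm_mul, RCLike.norm_conj]
      exact mul_lt_one_of_nonneg_of_lt_one_left (norm_nonneg _) hz hw.le
    rw [← sub_eq_zero.mp h0, norm_one] at this
    exact this.false
  have h2 := congrArg (wanderingEval V z) h
  rw [wanderingEval_coe hV hz, map_sub, map_smul, wanderingEval_apply_range hV hz, smul_smul]
    at h2
  rw [eq_inv_smul_iff₀ h0, sub_smul, one_smul, mul_comm z, h2]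

/-- **Wold decomposition** of a pure isometry `V`: the space is identified with `H²_W(𝔻)`,
`W` being the wandering subspace of `V`, through `x ↦ (w ↦ P_W (I - w V^*)⁻¹ x)`. -/
theorem exists_wold_model (hV : Isometry V)
    (hp : ∀ x, Tendsto (fun m : ℕ => (adjoint V ^ m) x) atTop (𝓝 0)) :
    ∃ U : H ≃ₗᵢ[ℂ] HardySpace 1 (wandering V), ∀ x (z : Polydisc 1),
      U x z = wanderingEval V (z.1 0) x := by
  let a (x : H) (k : Fin 1 → ℕ) : wandering V :=
    (wandering V).orthogonalProjectionOnto ((adjoint V ^ k 0) x)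
  have ha : ∀ x, HasSum (fun k => ‖a x k‖ ^ 2) (‖x‖ ^ 2) := fun x =>
    HardySpace.hasSum_one_variable.mp (hasSum_sq_norm_wandering hV (hp x))
  let u (x : H) : HardySpace 1 (wandering V) :=
    HardySpace.ofCoeff ⟨a x, HardySpace.memℓp_two_of_summable (ha x).summable⟩
  have hu : ∀ x z, u x z = wanderingEval V (z.1 0) x := fun x z => by
    have h := HardySpace.hasSum_one_variable.mpr (HardySpace.hasSum_apply (u x) z)
    refine h.unique ((hasSum_wanderingEval hV (z.2 0) x).congr_fun fun m => ?_)
    simp only [monomialAt, Finset.univ_unique, Finset.prod_singleton]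
    rfl
  let U : H →ₗᵢ[ℂ] HardySpace 1 (wandering V) :=
    { toFun := u
      map_add' := fun x y => RKHS.ext fun z => by
        rw [RKHS.coe_add (u x) (u y), Pi.add_apply, hu, hu, hu, map_add]
      map_smul' := fun c x => RKHS.ext fun z => by
        rw [RingHom.id_apply, RKHS.coe_smul (u x) c, Pi.smul_apply, hu, hu, map_smul]
      norm_map' := fun x => (sq_eq_sq₀ (norm_nonneg _) (norm_nonneg _)).mp
        ((HardySpace.hasSum_sq_norm_coeff (u x)).unique (ha x)) }
  have hsurj : Function.Surjective U := by
    have hcl : IsClosed (U.toLinearMap.range : Set (HardySpace 1 (wandering V))) := by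
      rw [LinearMap.coe_range]
      exact U.isometry.isClosedEmbedding.isClosed_range
    have : CompleteSpace U.toLinearMap.range := hcl.completeSpace_coe
    refine LinearMap.range_eq_top.mp ((Submodule.orthogonal_eq_bot_iff).mp ?_)
    -- The range contains all kernel functions, so that a function orthogonal to it vanishes.
    refine (Submodule.eq_bot_iff _).mpr fun f hf => RKHS.ext fun z => ?_
    refine ext_inner_left ℂ fun η => ?_
    obtain ⟨x, hx⟩ := exists_wanderingEval_eq hV (z.2 0) η
    have hker : U x = RKHS.kerFun (HardySpace 1 (wandering V)) z η := RKHS.ext fun y => by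
      rw [RKHS.kerFun_apply, HardySpace.kernel_HardySpace]
      refine (hu x y).trans ((hx _ (y.2 0)).trans ?_)
      simp
    rw [← RKHS.kerFun_inner, ← hker, RKHS.coe_zero, Pi.zero_apply, inner_zero_right]
    exact hf _ ⟨x, rfl⟩
  exact ⟨LinearIsometryEquiv.ofSurjective U hsurj, hu⟩

end Wold

/-! ### Restrictions to an invariant subspace -/

section Restriction

variable {n : ℕ} {E : Type*} [NormedAddCommGroup E] [InnerProductSpace ℂ E]

theorem ContinuousLinearMap.isometry_restrict {A : E →L[ℂ] E} (hA : Isometry A)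
    {S : Submodule ℂ E} (hS : ∀ x ∈ S, A x ∈ S) : Isometry (A.restrict hS) :=
  AddMonoidHomClass.isometry_of_norm _ fun x => hA.norm_map_of_map_zero (map_zero A) x

theorem ContinuousLinearMap.commute_restrict {A B : E →L[ℂ] E} (h : Commute A B)
    {S : Submodule ℂ E} (hA : ∀ x ∈ S, A x ∈ S) (hB : ∀ x ∈ S, B x ∈ S) :
    Commute (A.restrict hA) (B.restrict hB) :=
  ContinuousLinearMap.ext fun x => Subtype.ext (DFunLike.congr_fun h (x : E))

variable [CompleteSpace E]

theorem ContinuousLinearMap.adjoint_restrict_apply {A : E →L[ℂ] E} {S : Submodule ℂ E}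
    [CompleteSpace S] (hS : ∀ x ∈ S, A x ∈ S) (x : S) :
    adjoint (A.restrict hS) x = S.orthogonalProjectionOnto (adjoint A x) := by
  refine ext_inner_right ℂ fun y => ?_
  rw [adjoint_inner_left, Submodule.inner_orthogonalProjectionOnto_eq_of_mem_right,
    adjoint_inner_left]
  rfl

/-- The restriction of an operator with pure adjoint to an invariant subspace has pure adjoint,
since `(A|_S)^{*m} = P_S A^{*m}|_S`. -/
theorem ContinuousLinearMap.tendsto_adjoint_restrict_pow {A : E →L[ℂ] E}
    (hp : ∀ x, Tendsto (fun m : ℕ => (adjoint A ^ m) x) atTop (𝓝 0)) {S : Submodule ℂ E}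
    [CompleteSpace S] (hS : ∀ x ∈ S, A x ∈ S) (x : S) :
    Tendsto (fun m : ℕ => (adjoint (A.restrict hS) ^ m) x) atTop (𝓝 0) := by
  have h : ∀ m : ℕ, (adjoint (A.restrict hS) ^ m) x =
      S.orthogonalProjectionOnto ((adjoint A ^ m) x) := by
    intro m
    refine ext_inner_right ℂ fun y => ?_
    rw [Submodule.inner_orthogonalProjectionOnto_eq_of_mem_right]
    induction m generalizing y with
    | zero => rfl
    | succ m ih =>
      rw [pow_succ', pow_succ', ContinuousLinearMap.mul_def, ContinuousLinearMap.mul_def,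
        comp_apply, comp_apply, adjoint_inner_left, adjoint_inner_left, ih]
      rfl
  simp only [h]
  rw [← map_zero S.orthogonalProjectionOnto]
  exact (S.orthogonalProjectionOnto.continuous.tendsto 0).comp (hp x)

theorem commute_coordOp (i j : Fin n) : Commute (coordOp E i) (coordOp E j) :=
  ContinuousLinearMap.ext fun f => RKHS.ext fun z => by
    change coordOp E i (coordOp E j f) z = coordOp E j (coordOp E i f) z
    simp only [HardySpace.coordOp_apply]
    exact smul_comm _ _ _

theorem Mkappa_apply (i : Fin n) (f : HardySpace 1 (HardySpace n E)) (z : Polydisc 1) :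
    Mkappa E i f z = coordOp E i (f z) :=
  mulOp_apply _ _ f z

theorem commute_Mkappa_Mz (i : Fin n) : Commute (Mkappa E i) (Mz (HardySpace n E)) :=
  ContinuousLinearMap.ext fun f => RKHS.ext fun z => by
    change Mkappa E i (Mz _ f) z = Mz _ (Mkappa E i f) z
    simp only [Mz, HardySpace.coordOp_apply, Mkappa_apply, map_smul]

theorem commute_Mkappa (i j : Fin n) : Commute (Mkappa E i) (Mkappa E j) :=
  ContinuousLinearMap.ext fun f => RKHS.ext fun z => by
    change Mkappa E i (Mkappa E j f) z = Mkappa E j (Mkappa E i f) z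
    simp only [Mkappa_apply]
    exact DFunLike.congr_fun (commute_coordOp i j) (f z)

theorem isometry_Mkappa (i : Fin n) : Isometry (Mkappa E i) :=
  AddMonoidHomClass.isometry_of_norm _
    (HardySpace.norm_mulOp_const_apply (HardySpace.isometry_coordOp i))

end Restriction

namespace IsInvariantSubspace

variable {n : ℕ} {E : Type*} [NormedAddCommGroup E] [InnerProductSpace ℂ E] [CompleteSpace E]
  {S : ClosedSubmodule ℂ (HardySpace 1 (HardySpace n E))} (hS : IsInvariantSubspace S)

theorem isometry_restrictMz : Isometry hS.restrictMz :=
  isometry_restrict (HardySpace.isometry_coordOp 0) hS.1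

theorem commute_restrictMkappa_restrictMz (i : Fin n) :
    Commute (hS.restrictMkappa i) hS.restrictMz :=
  commute_restrict (commute_Mkappa_Mz i) (hS.2 i) hS.1

theorem commute_restrictMkappa (i j : Fin n) :
    Commute (hS.restrictMkappa i) (hS.restrictMkappa j) :=
  commute_restrict (commute_Mkappa i j) (hS.2 i) (hS.2 j)

theorem compressedAdjoint_eq : compressedAdjoint S.toSubmodule = adjoint hS.restrictMz :=
  ContinuousLinearMap.ext fun x => (adjoint_restrict_apply hS.1 x).symm

theorem Phi_apply (i : Fin n) (w : ℂ) (η : hS.W) :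
    hS.Phi i w η = wanderingEval hS.restrictMz w (hS.restrictMkappa i η) := by
  rw [Phi, symbol, hS.compressedAdjoint_eq]
  rfl

theorem analyticOnNhd_Phi (i : Fin n) : AnalyticOnNhd ℂ (hS.Phi i) (Metric.ball 0 1) := by
  have h := analyticOnNhd_wanderingEval hS.isometry_restrictMz
  have e : hS.Phi i = fun w => (compL ℂ hS.W S.toSubmodule hS.W).flip
      ((hS.restrictMkappa i).domRestrict hS.W) (wanderingEval hS.restrictMz w) :=
    funext fun w => ContinuousLinearMap.ext (hS.Phi_apply i w)
  rw [e]
  exact fun w hw => (ContinuousLinearMap.analyticAt _ _).comp (h w hw)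

/-- The Wold model of `M_z|_S`, in which `M_{κᵢ}|_S` is multiplication by `Φᵢ`. -/
theorem exists_model : ∃ U : S.toSubmodule ≃ₗᵢ[ℂ] HardySpace 1 hS.W,
    (∀ x, U (hS.restrictMz x) = Mz hS.W (U x)) ∧
      ∀ i x z, U (hS.restrictMkappa i x) z = onDisc (hS.Phi i) z (U x z) := by
  obtain ⟨U, hU⟩ := exists_wold_model hS.isometry_restrictMz
    (tendsto_adjoint_restrict_pow HardySpace.tendsto_adjoint_Mz_pow hS.1)
  refine ⟨U, fun x => RKHS.ext fun z => ?_, fun i x z => ?_⟩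
  · rw [Mz, HardySpace.coordOp_apply, hU, hU,
      wanderingEval_apply_range hS.isometry_restrictMz (z.2 0)]
  · rw [onDisc, Phi_apply, hU, hU, wanderingEval_apply_commute hS.isometry_restrictMz
      (hS.commute_restrictMkappa_restrictMz i) (z.2 0)]

theorem isMultiplier_Phi (i : Fin n) : IsMultiplier (onDisc (hS.Phi i)) := by
  obtain ⟨U, -, hU⟩ := hS.exists_model
  exact fun f => ⟨U (hS.restrictMkappa i (U.symm f)), fun z => by
    rw [hU, U.apply_symm_apply]⟩

theorem memHInfty_Phi (i : Fin n) : MemHInfty (hS.Phi i) :=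
  ⟨hS.analyticOnNhd_Phi i, ‖mulOp _ (hS.isMultiplier_Phi i)‖, fun w hw =>
    HardySpace.norm_apply_le_norm_mulOp (onDisc (hS.Phi i)) (hS.isMultiplier_Phi i)
      ⟨fun _ => w, fun _ => mem_ball_zero_iff.mp hw⟩⟩

end IsInvariantSubspace

theorem corollary3p6 {E : Type*} [NormedAddCommGroup E] [InnerProductSpace ℂ E] [CompleteSpace E]
    (n : ℕ) (S : ClosedSubmodule ℂ (HardySpace 1 (HardySpace n E))) (hS : IsInvariantSubspace S) :
    (∀ j, Isometry (hS.restrictTuple j)) ∧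
      (∀ j k, Commute (hS.restrictTuple j) (hS.restrictTuple k)) ∧
      (∀ i, MemHInfty (hS.Phi i)) ∧
      ∃ hΦ : ∀ i, IsMultiplier (onDisc (hS.Phi i)),
        UnitarilyEquivalent hS.restrictTuple (hS.modelTuple hΦ) := by
  refine ⟨Fin.cases hS.isometry_restrictMz fun i => isometry_restrict (isometry_Mkappa i) (hS.2 i),
    Fin.cases (Fin.cases (Commute.refl _) fun i =>
      (hS.commute_restrictMkappa_restrictMz i).symm) fun i =>
      Fin.cases (hS.commute_restrictMkappa_restrictMz i) (hS.commute_restrictMkappa i),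
    hS.memHInfty_Phi, hS.isMultiplier_Phi, ?_⟩
  obtain ⟨U, hUz, hUκ⟩ := hS.exists_model
  exact ⟨U, Fin.cases hUz fun i x => RKHS.ext fun z =>
    (hUκ i x z).trans (mulOp_apply _ (hS.isMultiplier_Phi i) (U x) z).symm⟩
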